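/- Let $\mathbb I=[0,1]$. A copula is a function $C:\mathbb I^2\to\mathbb I$ with $C(x,0)=C(0,x)=0$, $C(x,1)=C(1,x)=x$ for all $x$, and $C(b,d)+C(a,c)-C(b,c)-C(a,d)\ge 0$ whenever $a\le b$, $c\le d$. A quasi-copula is a function $Q:\mathbb I^2\to\mathbb I$ satisfying the same boundary conditions that is non-decreasing in each variable and satisfies $|Q(x,y)-Q(x',y')|\le|x-x'|+|y-y'|$. Let $\delta:\mathbb I\to\mathbb I$ be a diagonal section, i.e. $\delta(x)=C(x,x)$ for some copula $C$. Put $\widehat\delta(x)=x-\delta(x)$ and $\delta_M(x)=x$. Let $$\mu_\delta=\sup\Big\{\sup_{x,y\in\mathbb I}|C(x,y)-C(y,x)| : C\text{ a copula with } C(t,t)=\delta(t)\text{ for all }t\Big\}.$$ Let $\overline C_\delta$ be the pointwise supremum of all copulas with diagonal section $\delta$, let $B_\delta$ be the pointwise infimum of all quasi-copulas with diagonal section $\delta$, and let $(\overline C_\delta\boxslash B_\delta)(x,y)$ be $\overline C_\delta(x,y)$ if $x\le y$ and $B_\delta(x,y)$ if $x>y$. Let $\mathrm{TV}_x^y(\widehat\delta)$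 be the total variation of $\widehat\delta$ on $[x,y]$ if $x\le y$, and $-\mathrm{TV}_y^x(\widehat\delta)$ if $y<x$. Put $f^\delta(x,y)=y-\frac12\big(\widehat\delta(x)+\widehat\delta(y)+\mathrm{TV}_x^y(\widehat\delta)\big)$, let $D_f(\delta)$ be the union of the closure of $\{(x,y)\in\mathbb I^2: f^\delta(x,y)<\min\{x,y\}\}$ and the diagonal $\{(x,x):x\in\mathbb I\}$, and put $g_U^\delta(x)=\max\{y\in\mathbb I:(x,y)\in D_f(\delta)\}$. Put $h^\delta(x)=\max\{y\in\mathbb I: y\ge x,\ \widehat\delta(t)\ge\widehat\delta(x)\text{ for all }t\in[x,y]\}$ and $$H_\delta=\{(x,h^\delta(x)):x\in\mathbb I\}\cup\bigcup_{x}\{x\}\times\big[\liminf_{t\to x}h^\delta(t),\,h^\delta(x)\big],$$ where the union is over the discontinuities $x\in\mathbb I$ of $h^\delta$. Then: 1. If $x\in\mathbb I$ and $(x,g_U^\delta(x))\in H_\delta$, then $\min_{t\in[x,g_U^\delta(x)]}\widehat\delta(t)=\widehat\delta(x)$. 2. There is a point $x_0\in\mathbb I$ such that, with $y_0=g_U^\delta(x_0)$,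 $(x_0,y_0)\in H_\delta$ and $$\mu_\delta=(\overline C_\delta\boxslash B_\delta)(x_0,y_0)-(\overline C_\delta\boxslash B_\delta)(y_0,x_0)=\widehat\delta(x_0).$$ 3. If $\delta\ne\delta_M$, then $$\mu_\delta=\max\{\widehat\delta(x): x\in\mathbb I,\ (x,g_U^\delta(x))\in H_\delta,\ g_U^\delta(x)>x\},$$ and in particular this maximum exists. -/

import Mathlib

open Set Filter Topology unitInterval

noncomputable section

namespace DiagCopula

/-- A copula: grounded, with uniform marginals, and 2-increasing. -/
structure IsCopula (C : I → I → I) : Prop where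
  grounded_right : ∀ x, C x 0 = 0
  grounded_left : ∀ y, C 0 y = 0
  marginal_right : ∀ x, C x 1 = x
  marginal_left : ∀ y, C 1 y = y
  two_increasing : ∀ a b c d : I, a ≤ b → c ≤ d →
    0 ≤ (C b d : ℝ) + (C a c : ℝ) - (C b c : ℝ) - (C a d : ℝ)

/-- A quasi-copula: grounded, with uniform marginals, increasing in each variable,
and 1-Lipschitz (with respect to the sum of the coordinate distances). -/
structure IsQuasiCopula (Q : I → I → I) : Prop where
  grounded_right : ∀ x, Q x 0 = 0
  grounded_left : ∀ y, Q 0 y = 0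
  marginal_right : ∀ x, Q x 1 = x
  marginal_left : ∀ y, Q 1 y = y
  mono_left : ∀ x x' y : I, x ≤ x' → Q x y ≤ Q x' y
  mono_right : ∀ x y y' : I, y ≤ y' → Q x y ≤ Q x y'
  lipschitz : ∀ x y x' y' : I,
    |(Q x y : ℝ) - (Q x' y' : ℝ)| ≤ |(x : ℝ) - (x' : ℝ)| + |(y : ℝ) - (y' : ℝ)|

/-- The function `δ` is the diagonal section of `C`. -/
def HasDiagonal (C : I → I → I) (δ : I → I) : Prop :=
  ∀ x, C x x = δ x

/-- Diagonal sections are the diagonal sections of copulas. -/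
def IsDiagonalSection (δ : I → I) : Prop :=
  ∃ C, IsCopula C ∧ HasDiagonal C δ

/-- `δ̂(x) = x - δ(x)`. -/
def dhat (δ : I → I) (x : I) : ℝ :=
  (x : ℝ) - (δ x : ℝ)

/-- The asymmetry of `C`: the supremum norm of `C - Cᵗ`. -/
def asymmetry (C : I → I → I) : ℝ :=
  sSup {r : ℝ | ∃ x y : I, r = |(C x y : ℝ) - (C y x : ℝ)|}

/-- The supremum of the asymmetries of all copulas with diagonal section `δ`. -/
def maxAsymmetry (δ : I → I) : ℝ :=
  sSup {r : ℝ | ∃ C, IsCopula C ∧ HasDiagonal C δ ∧ r = asymmetry C}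

/-- The pointwise supremum of all copulas with diagonal section `δ`. -/
def upperBound (δ : I → I) (x y : I) : I :=
  sSup {z : I | ∃ C, IsCopula C ∧ HasDiagonal C δ ∧ z = C x y}

/-- The Bertino copula: the pointwise infimum of all quasi-copulas with diagonal section `δ`. -/
def bertino (δ : I → I) (x y : I) : I :=
  sInf {z : I | ∃ Q, IsQuasiCopula Q ∧ HasDiagonal Q δ ∧ z = Q x y}

/-- The diagonal splice: `Q₁` above the diagonal, `Q₂` below it. -/
def splice (Q₁ Q₂ : I → I → I) (x y : I) : I :=
  if x ≤ y then Q₁ x y else Q₂ x y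

/-- `f(x,y) = y - (δ̂(x) + δ̂(y) + TV_x^y(δ̂)) / 2`, where `TV_x^y = -TV_y^x` for `y < x`
(this is the convention of `variationOnFromTo`). -/
def auxF (δ : I → I) (x y : I) : ℝ :=
  (y : ℝ) - (dhat δ x + dhat δ y + variationOnFromTo (dhat δ) univ x y) / 2

/-- The set where `f` lies strictly below `min{x,y}`. -/
def openRegion (δ : I → I) : Set (I × I) :=
  {p | auxF δ p.1 p.2 < min (p.1 : ℝ) (p.2 : ℝ)}

/-- The closure of that set, together with the main diagonal. -/
def region (δ : I → I) : Set (I × I) :=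
  closure (openRegion δ) ∪ {p | p.1 = p.2}

/-- The upper boundary function of the region (the supremum is a maximum: the region is closed
and contains the diagonal). -/
def gU (δ : I → I) (x : I) : I :=
  sSup {y : I | (x, y) ∈ region δ}

/-- `h(x)` is the largest `y ≥ x` with `δ̂(t) ≥ δ̂(x)` for all `t ∈ [x,y]` (the supremum is a
maximum, since `δ̂` is continuous when `δ` is a diagonal section). -/
def hFun (δ : I → I) (x : I) : I :=
  sSup {y : I | x ≤ y ∧ ∀ t ∈ Icc x y, dhat δ x ≤ dhat δ t}

/-- The graph of `h` with the vertical segment from `liminf_{t → x} h(t)` to `h(x)` added at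
each discontinuity `x` of `h`. -/
def HSet (δ : I → I) : Set (I × I) :=
  {p | p.2 = hFun δ p.1} ∪
    {p | ¬ ContinuousAt (hFun δ) p.1 ∧
      p.2 ∈ Icc (liminf (hFun δ) (𝓝[≠] p.1)) (hFun δ p.1)}

end DiagCopula

end

/-! Write `D` for `dhat δ`, `T` for its cumulative variation and `F(x,y)` for `upperF D T x y`. For
`x ≤ y` every copula with diagonal `δ` satisfies `C x y ≤ min(x, F(x,y))` (`IsCopula.le_auxF`) and
`C y x ≥ x - min D` over `[x,y]` (`IsQuasiCopula.sub_dhat_le`). Pasting these two bounds along the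
diagonal gives a copula (`Profile.exists_isCopula`), so both are attained together.

The asymmetry problem thus becomes: maximize `min D` over `[x,y]` subject to `x ≤ F(x,y)`. Pairs
violating the constraint gain nothing (`min_sub_le`). Compactness provides the maximum `M`. Since
`F(x, gU x) = x`, each `x` with `(x, gU x) ∈ HSet δ` is feasible with value `D x`, hence `D x ≤ M`;
the rightmost optimal `x` with `D x = M` lies in this set (`exists_mem_HSet`). If `D` is not
identically zero then `M > 0`, which forces `x < gU x`. -/

namespace DiagCopula

/-! ### Elementary copula estimates and pasting along the diagonal -/

theorem IsCopula.lipschitz_left {C : I → I → I} (hC : IsCopula C) {x x' : I} (h : x ≤ x') (y : I) :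
    0 ≤ (C x' y : ℝ) - C x y ∧ (C x' y : ℝ) - C x y ≤ x' - x := by
  have h1 := hC.two_increasing x x' 0 y h unitInterval.nonneg'
  have h2 := hC.two_increasing x x' y 1 h unitInterval.le_one'
  simp only [hC.grounded_right, hC.marginal_right, Icc.coe_zero] at h1 h2
  constructor <;> linarith

theorem IsCopula.transpose {C : I → I → I} (hC : IsCopula C) : IsCopula fun x y ↦ C y x where
  grounded_right := hC.grounded_left
  grounded_left := hC.grounded_right
  marginal_right := hC.marginal_left
  marginal_left := hC.marginal_right
  two_increasing a b c d hab hcd := by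
    have := hC.two_increasing c d a b hcd hab
    linarith

theorem IsCopula.lipschitz_right {C : I → I → I} (hC : IsCopula C) (x : I) {y y' : I} (h : y ≤ y') :
    0 ≤ (C x y' : ℝ) - C x y ∧ (C x y' : ℝ) - C x y ≤ y' - y :=
  hC.transpose.lipschitz_left h x

theorem IsCopula.isQuasiCopula {C : I → I → I} (hC : IsCopula C) : IsQuasiCopula C where
  grounded_right := hC.grounded_right
  grounded_left := hC.grounded_left
  marginal_right := hC.marginal_right
  marginal_left := hC.marginal_left
  mono_left x x' y h := Subtype.coe_le_coe.1 (by linarith [hC.lipschitz_left h y])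
  mono_right x y y' h := Subtype.coe_le_coe.1 (by linarith [hC.lipschitz_right x h])
  lipschitz x y x' y' := by
    have h1 : |(C x y : ℝ) - C x' y| ≤ |(x : ℝ) - x'| := by
      rcases le_total x x' with h | h <;> have h2 := hC.lipschitz_left h y
      · rw [abs_sub_comm, abs_sub_comm (x : ℝ), abs_of_nonneg h2.1]
        exact h2.2.trans (le_abs_self _)
      · rw [abs_of_nonneg h2.1]
        exact h2.2.trans (le_abs_self _)
    have h1' : |(C x' y : ℝ) - C x' y'| ≤ |(y : ℝ) - y'| := by
      rcases le_total y y' with h | h <;> have h2 := hC.lipschitz_right x' h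
      · rw [abs_sub_comm, abs_sub_comm (y : ℝ), abs_of_nonneg h2.1]
        exact h2.2.trans (le_abs_self _)
      · rw [abs_of_nonneg h2.1]
        exact h2.2.trans (le_abs_self _)
    linarith [abs_sub_le (C x y : ℝ) (C x' y) (C x' y')]

/-- A grounded real function with uniform marginals and nonnegative rectangle volumes is a
copula. -/
theorem exists_isCopula_of_real (c : I → I → ℝ) (h1 : ∀ x, c x 0 = 0) (h2 : ∀ y, c 0 y = 0)
    (h3 : ∀ x, c x 1 = x) (h4 : ∀ y, c 1 y = y)
    (h5 : ∀ x x' y y', x ≤ x' → y ≤ y' → 0 ≤ c x' y' + c x y - c x' y - c x y') :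
    ∃ C : I → I → I, IsCopula C ∧ ∀ x y, (C x y : ℝ) = c x y := by
  have hmem (x y : I) : c x y ∈ I := by
    have e1 := h5 0 x 0 y unitInterval.nonneg' unitInterval.nonneg'
    have e2 := h5 0 x y 1 unitInterval.nonneg' unitInterval.le_one'
    simp only [h1, h2, h3] at e1 e2
    exact ⟨by linarith, by linarith [unitInterval.le_one x]⟩
  refine ⟨fun x y ↦ ⟨c x y, hmem x y⟩, ⟨fun x ↦ ?_, fun x ↦ ?_, fun x ↦ ?_, fun x ↦ ?_, ?_⟩,
    fun _ _ ↦ rfl⟩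
  · exact Subtype.ext (h1 x)
  · exact Subtype.ext (h2 x)
  · exact Subtype.ext (h3 x)
  · exact Subtype.ext (h4 x)
  · exact fun x x' y y' hx hy ↦ h5 x x' y y' hx hy

/-- Pasting `U` above the diagonal and the transpose of `V` below it gives a function with
nonnegative rectangle volumes, as soon as this holds for rectangles on either side of the diagonal
and for squares centred on it. -/
theorem paste_two_increasing {c U V : I → I → ℝ}
    (hcU : ∀ x y, x ≤ y → c x y = U x y) (hcV : ∀ x y, x ≤ y → c y x = V x y)
    (hU : ∀ x x' y y', x ≤ x' → x' ≤ y → y ≤ y' → 0 ≤ U x' y' + U x y - U x' y - U x y')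
    (hV : ∀ x x' y y', x ≤ x' → x' ≤ y → y ≤ y' → 0 ≤ V x' y' + V x y - V x' y - V x y')
    (hUV : ∀ x y, x ≤ y → 0 ≤ c y y + c x x - U x y - V x y)
    (a b p q : I) (hab : a ≤ b) (hpq : p ≤ q) : 0 ≤ c b q + c a p - c b p - c a q := by
  have up (x x' y y' : I) (h1 : x ≤ x') (h2 : x' ≤ y) (h3 : y ≤ y') :
      0 ≤ c x' y' + c x y - c x' y - c x y' := by
    rw [hcU _ _ (h2.trans h3), hcU _ _ (h1.trans h2), hcU _ _ h2, hcU _ _ (h1.trans (h2.trans h3))]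
    exact hU x x' y y' h1 h2 h3
  have lo (x x' y y' : I) (h1 : x ≤ x') (h2 : x' ≤ y) (h3 : y ≤ y') :
      0 ≤ c y' x' + c y x - c y x' - c y' x := by
    rw [hcV _ _ (h2.trans h3), hcV _ _ (h1.trans h2), hcV _ _ h2, hcV _ _ (h1.trans (h2.trans h3))]
    exact hV x x' y y' h1 h2 h3
  have sq (x y : I) (h : x ≤ y) : 0 ≤ c y y + c x x - c x y - c y x := by
    rw [hcU _ _ h, hcV _ _ h]
    exact hUV x y h
  rcases le_total b p with h | hpb
  · exact up a b p q hab h hpq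
  rcases le_total q a with h | haq
  · linarith [lo p q a b hpq h hab]
  -- The sides overlap: cut out the diagonal square on `[max a p, min b q]`; the remaining pieces
  -- lie on one side of the diagonal.
  rcases le_total a p with h1 | h1 <;> rcases le_total b q with h2 | h2
  · linarith [up a p p q h1 le_rfl hpq, up p b b q hpb le_rfl h2, sq p b hpb]
  · linarith [up a p p q h1 le_rfl hpq, lo p q q b hpq le_rfl h2, sq p q hpq]
  · linarith [lo p a a b h1 le_rfl hab, up a b b q hab le_rfl h2, sq a b hab]
  · linarith [lo p a a b h1 le_rfl hab, up a q q q haq le_rfl le_rfl, sq a q haq,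
      lo a q q b haq le_rfl h2]

/-! ### Variation of `dhat δ` and pointwise bounds for copulas -/

theorem eVariationOn_le_of_abs_sub_le {g w : I → ℝ} {x y : I}
    (h : ∀ s ∈ Icc x y, ∀ t ∈ Icc x y, s ≤ t → |g t - g s| ≤ w t - w s) (hxy : x ≤ y) :
    eVariationOn g (univ ∩ Icc x y) ≤ ENNReal.ofReal (w y - w x) := by
  have hw : MonotoneOn w (Icc x y) := fun s hs t ht hst ↦ by
    linarith [abs_nonneg (g t - g s), h s hs t ht hst]
  have hle := (hw.eVariationOn_eq (left_mem_Icc.2 hxy) (right_mem_Icc.2 hxy)).le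
  rw [inter_self] at hle
  rw [univ_inter]
  refine le_trans (iSup_le fun p ↦ ?_) hle
  refine le_trans (Finset.sum_le_sum fun i _ ↦ ?_)
    (eVariationOn.sum_le (f := w) (n := p.1) p.2.2.1 p.2.2.2)
  rw [edist_dist, edist_dist, Real.dist_eq, Real.dist_eq]
  exact ENNReal.ofReal_le_ofReal
    ((h _ (p.2.2.2 i) _ (p.2.2.2 (i + 1)) (p.2.2.1 i.le_succ)).trans (le_abs_self _))

theorem variationOnFromTo_le_of_abs_sub_le {g w : I → ℝ} {x y : I}
    (h : ∀ s ∈ Icc x y, ∀ t ∈ Icc x y, s ≤ t → |g t - g s| ≤ w t - w s) (hxy : x ≤ y) :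
    variationOnFromTo g univ x y ≤ w y - w x := by
  rw [variationOnFromTo.eq_of_le _ _ hxy]
  refine ENNReal.toReal_le_of_le_ofReal ?_ (eVariationOn_le_of_abs_sub_le h hxy)
  linarith [abs_nonneg (g y - g x), h x (left_mem_Icc.2 hxy) y (right_mem_Icc.2 hxy) hxy]

/-- `D` is a nonnegative function on the unit interval that vanishes at both end points, and `T` is
a 1-Lipschitz function whose increments dominate those of `D`. -/
structure Profile (D T : I → ℝ) : Prop where
  nonneg : ∀ x, 0 ≤ D x
  zero : D 0 = 0
  one : D 1 = 0
  abs_sub_le : ∀ s t, s ≤ t → |D t - D s| ≤ T t - T s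
  sub_le : ∀ s t : I, s ≤ t → T t - T s ≤ t - s

/-- The total variation of `δ̂` on `[0, x]`. -/
noncomputable def totVar (δ : I → I) (x : I) : ℝ := variationOnFromTo (dhat δ) univ 0 x

theorem IsCopula.abs_dhat_sub_le {C : I → I → I} {δ : I → I} (hC : IsCopula C)
    (hd : HasDiagonal C δ) {s t : I} (h : s ≤ t) : |dhat δ t - dhat δ s| ≤ t - s := by
  have h1 := hC.lipschitz_left h s
  have h2 := hC.lipschitz_right t h
  rw [hd s] at h1
  rw [hd t] at h2
  unfold dhat
  rw [abs_le]
  constructor <;> linarith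

theorem IsCopula.le_left {C : I → I → I} (hC : IsCopula C) (x y : I) : (C x y : ℝ) ≤ x := by
  have h := hC.lipschitz_right x (unitInterval.le_one' (t := y))
  rw [hC.marginal_right] at h
  linarith

theorem IsDiagonalSection.locallyBoundedVariationOn {δ : I → I} (hδ : IsDiagonalSection δ) :
    LocallyBoundedVariationOn (dhat δ) univ := by
  obtain ⟨C, hC, hd⟩ := hδ
  intro x y _ _
  rcases le_total x y with h | h
  · exact ne_top_of_le_ne_top ENNReal.ofReal_ne_top (eVariationOn_le_of_abs_sub_le
      (w := fun z : I ↦ (z : ℝ)) (fun s _ t _ hst ↦ hC.abs_dhat_sub_le hd hst) h)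
  · refine BoundedVariationOn.of_subsingleton ?_
    rw [univ_inter]
    exact subsingleton_Icc_of_ge h

theorem IsDiagonalSection.variationOnFromTo_eq {δ : I → I} (hδ : IsDiagonalSection δ) (x y : I) :
    variationOnFromTo (dhat δ) univ x y = totVar δ y - totVar δ x := by
  have h := variationOnFromTo.add hδ.locallyBoundedVariationOn (mem_univ 0) (mem_univ x)
    (mem_univ y)
  unfold totVar
  linarith

theorem IsDiagonalSection.profile {δ : I → I} (hδ : IsDiagonalSection δ) :
    Profile (dhat δ) (totVar δ) := by
  have hv := hδ.variationOnFromTo_eq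
  have hb := hδ.locallyBoundedVariationOn
  obtain ⟨C, hC, hd⟩ := hδ
  refine ⟨fun x ↦ ?_, ?_, ?_, fun s t h ↦ ?_, fun s t h ↦ ?_⟩
  · have := hC.le_left x x
    rw [hd x] at this
    exact sub_nonneg.2 this
  · simp [dhat, ← hd 0, hC.grounded_left]
  · simp [dhat, ← hd 1, hC.marginal_left]
  · rw [← hv, ← Real.dist_eq, dist_comm, variationOnFromTo.eq_of_le _ _ h]
    exact (hb s t (mem_univ s) (mem_univ t)).dist_le ⟨mem_univ s, left_mem_Icc.2 h⟩
      ⟨mem_univ t, right_mem_Icc.2 h⟩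
  · rw [← hv]
    exact variationOnFromTo_le_of_abs_sub_le (w := fun z : I ↦ (z : ℝ))
      (fun s _ t _ hst ↦ hC.abs_dhat_sub_le hd hst) h

/-- The increments of `dhat δ` on `[x,y]` are dominated by those of `w u = 2(u - C x u) - dhat δ u`:
this amounts to `C x t - C x s ≤ min(t - s, δ t - δ s)`. Comparing the total variation with `w y - w
x` gives the bound. -/
theorem IsCopula.le_auxF {C : I → I → I} {δ : I → I} (hC : IsCopula C)
    (hd : HasDiagonal C δ) {x y : I} (hxy : x ≤ y) : (C x y : ℝ) ≤ auxF δ x y := by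
  have key := variationOnFromTo_le_of_abs_sub_le (g := dhat δ)
    (w := fun u : I ↦ 2 * ((u : ℝ) - C x u) - dhat δ u) (x := x) (y := y) (fun s hs t _ hst ↦ ?_) hxy
  · simp only [hd x] at key
    unfold auxF
    unfold dhat at *
    linarith
  · have h1 := hC.lipschitz_right x hst
    have h2 := hC.two_increasing x s s t hs.1 hst
    have h3 := hC.lipschitz_left hst t
    rw [hd t] at h3
    rw [hd s] at h2
    unfold dhat
    rw [abs_le]
    constructor <;> linarith

/-- Moving from `(t,t)` down to `(t,x)` loses at most `t - x`, and moving on to `(y,x)` loses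
nothing. -/
theorem IsQuasiCopula.sub_dhat_le {Q : I → I → I} {δ : I → I} (hQ : IsQuasiCopula Q)
    (hd : HasDiagonal Q δ) {x y t : I} (ht : t ∈ Icc x y) : (x : ℝ) - dhat δ t ≤ Q y x := by
  have h1 := hQ.lipschitz t t t x
  have h2 : (Q t x : ℝ) ≤ Q y x := hQ.mono_left t y x ht.2
  have h3 : (0 : ℝ) ≤ t - x := sub_nonneg.2 ht.1
  rw [sub_self, abs_zero, zero_add, abs_of_nonneg h3, hd t] at h1
  unfold dhat
  linarith [(abs_le.1 h1).2]

/-! ### The two extremal bounds and the copula pasted from them -/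

/-- `y - (D(x) + D(y) + T(y) - T(x)) / 2`. -/
noncomputable def upperF (D T : I → ℝ) (x y : I) : ℝ := y - (D x + D y + (T y - T x)) / 2

theorem IsDiagonalSection.auxF_eq {δ : I → I} (hδ : IsDiagonalSection δ) :
    auxF δ = upperF (dhat δ) (totVar δ) := by
  funext x y
  rw [auxF, upperF, hδ.variationOnFromTo_eq]

theorem upperF_self (D T : I → ℝ) (x : I) : upperF D T x x = x - D x := by
  unfold upperF
  ring

/-- The minimum of `D` on `[x, y]`. -/
noncomputable def intervalMin (D : I → ℝ) (x y : I) : ℝ := sInf (D '' Icc x y)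

namespace Profile

variable {D T : I → ℝ}

theorem continuous_left (h : Profile D T) : Continuous D := by
  refine (LipschitzWith.of_le_add_mul 1 fun x y ↦ ?_).continuous
  rw [Subtype.dist_eq, Real.dist_eq, NNReal.coe_one, one_mul]
  rcases le_total x y with hxy | hxy
  · have := abs_le.1 (h.abs_sub_le x y hxy)
    rw [abs_sub_comm]
    linarith [h.sub_le x y hxy, le_abs_self ((y : ℝ) - x)]
  · have := abs_le.1 (h.abs_sub_le y x hxy)
    linarith [h.sub_le y x hxy, le_abs_self ((x : ℝ) - y)]

theorem mono_right (h : Profile D T) : Monotone T := fun s t hst ↦ by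
  linarith [h.abs_sub_le s t hst, abs_nonneg (D t - D s)]

theorem continuous_right (h : Profile D T) : Continuous T := by
  refine (LipschitzWith.of_le_add_mul 1 fun x y ↦ ?_).continuous
  rw [Subtype.dist_eq, Real.dist_eq, NNReal.coe_one, one_mul]
  rcases le_total x y with hxy | hxy
  · linarith [h.mono_right hxy, abs_nonneg ((x : ℝ) - y)]
  · linarith [h.sub_le y x hxy, le_abs_self ((x : ℝ) - y)]

theorem le_one_sub (h : Profile D T) (x : I) : D x ≤ 1 - x := by
  have h1 := abs_le.1 (h.abs_sub_le x 1 unitInterval.le_one')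
  have h2 := h.sub_le x 1 unitInterval.le_one'
  rw [h.one] at h1
  rw [Icc.coe_one] at h2
  linarith

theorem continuous_upperF (h : Profile D T) : Continuous fun p : I × I ↦ upperF D T p.1 p.2 := by
  have h1 := h.continuous_left
  have h2 := h.continuous_right
  unfold upperF
  fun_prop

theorem le_upperF_one (h : Profile D T) (x : I) : (x : ℝ) ≤ upperF D T x 1 := by
  have h1 := h.le_one_sub x
  have h2 := h.sub_le x 1 unitInterval.le_one'
  rw [Icc.coe_one] at h2
  rw [upperF, h.one, Icc.coe_one]
  linarith

theorem upperF_mono_left (h : Profile D T) {x x' : I} (hx : x ≤ x') (y : I) : upperF D T x y ≤ upperF D T x' y := by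
  have := abs_le.1 (h.abs_sub_le x x' hx)
  unfold upperF
  linarith

theorem upperF_sub_antitone (h : Profile D T) {x x' : I} (hx : x ≤ x') (y : I) :
    upperF D T x' y - x' ≤ upperF D T x y - x := by
  have h1 := abs_le.1 (h.abs_sub_le x x' hx)
  have h2 := h.sub_le x x' hx
  unfold upperF
  linarith

theorem upperF_mono_right (h : Profile D T) (x : I) {y y' : I} (hy : y ≤ y') :
    upperF D T x y ≤ upperF D T x y' := by
  have h1 := abs_le.1 (h.abs_sub_le y y' hy)
  have h2 := h.sub_le y y' hy
  unfold upperF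
  linarith

/-- Along `y`, any drop of `D` is paid for by growth of `upperF`; this controls minimizers lying
beyond a given `y`. -/
theorem sub_le_upperF_sub (h : Profile D T) (x : I) {y y' : I} (hy : y ≤ y') :
    D y - D y' ≤ upperF D T x y' - upperF D T x y := by
  have h1 := abs_le.1 (h.abs_sub_le y y' hy)
  have h2 := h.sub_le y y' hy
  unfold upperF
  linarith

theorem isLeast_intervalMin (h : Profile D T) {x y : I} (hxy : x ≤ y) :
    IsLeast (D '' Icc x y) (intervalMin D x y) :=
  (isCompact_Icc.image h.continuous_left).isLeast_sInf ((nonempty_Icc.2 hxy).image D)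

theorem intervalMin_le (h : Profile D T) {x y t : I} (hxt : x ≤ t) (hty : t ≤ y) : intervalMin D x y ≤ D t :=
  (h.isLeast_intervalMin (hxt.trans hty)).2 (mem_image_of_mem D ⟨hxt, hty⟩)

theorem exists_eq_intervalMin (h : Profile D T) {x y : I} (hxy : x ≤ y) :
    ∃ t, x ≤ t ∧ t ≤ y ∧ D t = intervalMin D x y := by
  obtain ⟨t, ht, h1⟩ := (h.isLeast_intervalMin hxy).1
  exact ⟨t, ht.1, ht.2, h1⟩

theorem intervalMin_eq_zero (h : Profile D T) {x y : I} (hxy : x ≤ y) (h0 : D x = 0 ∨ D y = 0) :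
    intervalMin D x y = 0 := by
  obtain ⟨t, _, _, h3⟩ := h.exists_eq_intervalMin hxy
  refine le_antisymm ?_ (h3 ▸ h.nonneg t)
  rcases h0 with h0 | h0
  · exact h0 ▸ h.intervalMin_le le_rfl hxy
  · exact h0 ▸ h.intervalMin_le hxy le_rfl

/-- `upperF` splits as a function of `x` plus a function of `y`, so `min(x, F) = x + min(0, F - x)`
applies a concave function to a sum that decreases in `x` and increases in `y`. -/
theorem min_upperF_rectangle (h : Profile D T) {x x' y y' : I} (hx : x ≤ x') (hy : y ≤ y') :
    0 ≤ min (x' : ℝ) (upperF D T x' y') + min (x : ℝ) (upperF D T x y)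
      - min (x' : ℝ) (upperF D T x' y) - min (x : ℝ) (upperF D T x y') := by
  have h1 := h.upperF_sub_antitone hx y
  have h2 := h.upperF_sub_antitone hx y'
  have h3 := h.upperF_mono_right x hy
  have h4 := h.upperF_mono_right x' hy
  have h5 := h.upperF_mono_left hx y
  have h6 : upperF D T x' y' + upperF D T x y = upperF D T x' y + upperF D T x y' := by
    unfold upperF
    ring
  have h7 : (x : ℝ) ≤ x' := hx
  rcases min_cases (x' : ℝ) (upperF D T x' y') with ⟨e1, _⟩ | ⟨e1, _⟩ <;>
  rcases min_cases (x : ℝ) (upperF D T x y) with ⟨e2, _⟩ | ⟨e2, _⟩ <;>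
  rw [e1, e2] <;>
  linarith [min_le_left (x' : ℝ) (upperF D T x' y), min_le_right (x' : ℝ) (upperF D T x' y),
    min_le_left (x : ℝ) (upperF D T x y'), min_le_right (x : ℝ) (upperF D T x y')]

/-- A minimizer on `[x,y']` lies in `[x,y]` or in `[x',y']`, while a minimizer on the intersection
`[x',y]` lies in both. -/
theorem intervalMin_rectangle (h : Profile D T) {x x' y y' : I} (hx : x ≤ x') (hxy : x' ≤ y) (hy : y ≤ y') :
    intervalMin D x' y' + intervalMin D x y ≤ intervalMin D x' y + intervalMin D x y' := by
  obtain ⟨s, hs1, hs2, hs⟩ := h.exists_eq_intervalMin hxy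
  obtain ⟨t, ht1, ht2, ht⟩ := h.exists_eq_intervalMin (hx.trans (hxy.trans hy))
  rw [← hs, ← ht]
  rcases le_total t y with hty | hty
  · linarith [h.intervalMin_le ht1 hty, h.intervalMin_le hs1 (hs2.trans hy)]
  · linarith [h.intervalMin_le (hxy.trans hty) ht2, h.intervalMin_le (hx.trans hs1) hs2]

/-- The copula that is the exact upper bound above the diagonal and the Bertino copula
below it. -/
theorem exists_isCopula (h : Profile D T) : ∃ C : I → I → I, IsCopula C ∧
    (∀ x y, x ≤ y → (C x y : ℝ) = min (x : ℝ) (upperF D T x y)) ∧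
    (∀ x y, x ≤ y → (C y x : ℝ) = x - intervalMin D x y) := by
  let c : I → I → ℝ := fun x y ↦
    if x ≤ y then min (x : ℝ) (upperF D T x y) else y - intervalMin D y x
  have hself (x : I) : intervalMin D x x = D x := by
    simp [intervalMin]
  have hdiag (x : I) : min (x : ℝ) (upperF D T x x) = x - D x := by
    rw [upperF_self, min_eq_right]
    linarith [h.nonneg x]
  have hcU (x y : I) (hxy : x ≤ y) : c x y = min (x : ℝ) (upperF D T x y) := if_pos hxy
  have hcV (x y : I) (hxy : x ≤ y) : c y x = x - intervalMin D x y := by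
    rcases hxy.lt_or_eq with hlt | rfl
    · exact if_neg hlt.not_ge
    · rw [hcU x x le_rfl, hdiag, hself]
  obtain ⟨C, hC, hCc⟩ := exists_isCopula_of_real c
    (fun x ↦ by
      rw [hcV 0 x unitInterval.nonneg', h.intervalMin_eq_zero unitInterval.nonneg' (.inl h.zero),
        Icc.coe_zero, sub_zero])
    (fun y ↦ by
      have h1 := h.upperF_mono_right 0 (unitInterval.nonneg' (t := y))
      rw [upperF_self, h.zero, Icc.coe_zero, sub_zero] at h1
      rw [hcU 0 y unitInterval.nonneg', Icc.coe_zero, min_eq_left h1])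
    (fun x ↦ by rw [hcU x 1 unitInterval.le_one', min_eq_left (h.le_upperF_one x)])
    (fun y ↦ by
      rw [hcV y 1 unitInterval.le_one', h.intervalMin_eq_zero unitInterval.le_one' (.inr h.one),
        sub_zero])
    (fun x x' y y' hx hy ↦ by
      refine paste_two_increasing hcU hcV (fun _ _ _ _ h1 _ h3 ↦ h.min_upperF_rectangle h1 h3)
        (fun _ _ _ _ h1 h2 h3 ↦ ?_) (fun a b hab ↦ ?_) x x' y y' hx hy
      · linarith [h.intervalMin_rectangle h1 h2 h3]
      -- After bounding the minimum by `upperF`, the square condition reads `D a + D b ≤ 2 D t + T b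
      -- - T a`; compare `D` with `T` on `[a,t]` and `[t,b]`.
      · obtain ⟨t, hat, htb, ht⟩ := h.exists_eq_intervalMin hab
        have e1 := min_le_right (a : ℝ) (upperF D T a b)
        have e2 := abs_le.1 (h.abs_sub_le a t hat)
        have e3 := abs_le.1 (h.abs_sub_le t b htb)
        rw [hcU _ _ le_rfl, hcU _ _ le_rfl, hdiag, hdiag, ← ht]
        unfold upperF at e1 ⊢
        linarith)
  exact ⟨C, hC, fun x y hxy ↦ (hCc x y).trans (hcU x y hxy),
    fun x y hxy ↦ (hCc y x).trans (hcV x y hxy)⟩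

/-- The greatest value of the minimum of `D` on `[x, y]` over all `x ≤ y` with
`x ≤ upperF D T x y` exists. -/
theorem exists_max_intervalMin (h : Profile D T) : ∃ M : ℝ, 0 ≤ M ∧
    (∀ x y : I, x ≤ y → (x : ℝ) ≤ upperF D T x y → ∃ t ∈ Icc x y, D t ≤ M) ∧
    ∃ x y : I, x ≤ y ∧ (x : ℝ) ≤ upperF D T x y ∧ ∀ t ∈ Icc x y, M ≤ D t := by
  have hD := h.continuous_left
  have hF := h.continuous_upperF
  -- Clamping `s` to `[x,y]` turns the quantifier over a moving interval into an intersection of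
  -- closed conditions.
  let K : Set (I × I × I) := {p | p.1 ≤ p.2.1 ∧ (p.1 : ℝ) ≤ upperF D T p.1 p.2.1 ∧
    ∀ s : I, (p.2.2 : ℝ) ≤ D (max p.1 (min s p.2.1))}
  have hK : IsClosed K := by
    refine (isClosed_le (by fun_prop) (by fun_prop)).inter
      ((isClosed_le (by fun_prop) (hF.comp (by fun_prop : Continuous fun p : I × I × I ↦
        (p.1, p.2.1)))).inter ?_)
    have hI : IsClosed (⋂ s : I, {p : I × I × I | (p.2.2 : ℝ) ≤ D (max p.1 (min s p.2.1))}) :=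
      isClosed_iInter fun s ↦ isClosed_le (by fun_prop) (by fun_prop)
    rwa [← ofPred_forall] at hI
  have hKn : ((1, 1, 0) : I × I × I) ∈ K :=
    ⟨le_rfl, h.le_upperF_one 1, fun s ↦ by simpa using h.nonneg _⟩
  obtain ⟨⟨x, y, c⟩, ⟨h1, h2, h3⟩, hmax⟩ := hK.isCompact.exists_isMaxOn ⟨_, hKn⟩
    (f := fun p : I × I × I ↦ (p.2.2 : ℝ)) (by fun_prop)
  refine ⟨c, c.2.1, fun x' y' hxy hF' ↦ ?_, x, y, h1, h2, fun t ht ↦ ?_⟩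
  · obtain ⟨t, ht1, ht2, ht⟩ := h.exists_eq_intervalMin hxy
    refine ⟨t, ⟨ht1, ht2⟩, ?_⟩
    have hmem : D t ∈ I := ⟨h.nonneg t, by linarith [h.le_one_sub t, t.2.1]⟩
    refine hmax (a := (x', y', ⟨D t, hmem⟩)) ⟨hxy, hF', fun s ↦ ?_⟩
    exact ht.trans_le <| h.intervalMin_le (le_max_left _ _) (max_le hxy (min_le_right _ _))
  · have := h3 t
    rwa [min_eq_left ht.2, max_eq_right ht.1] at this

end Profile

/-! ### The boundary functions `gU` and `hFun` -/

section Boundary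

variable {δ : I → I}

theorem isGreatest_hFun (hD : Continuous (dhat δ)) (x : I) :
    IsGreatest {y : I | x ≤ y ∧ ∀ t ∈ Icc x y, dhat δ x ≤ dhat δ t} (hFun δ x) := by
  have hset : {y : I | x ≤ y ∧ ∀ t ∈ Icc x y, dhat δ x ≤ dhat δ t} =
      Ici x ∩ ⋂ s : I, {y : I | dhat δ x ≤ dhat δ (max x (min s y))} := by
    ext y
    simp only [mem_inter_iff, mem_iInter, mem_Ici, mem_ofPred_eq]
    refine and_congr_right fun hxy ↦ ⟨fun h s ↦ ?_, fun h t ht ↦ ?_⟩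
    · exact h _ ⟨le_max_left _ _, max_le hxy (min_le_right _ _)⟩
    · have := h t
      rwa [min_eq_left ht.2, max_eq_right ht.1] at this
  have hcl : IsClosed {y : I | x ≤ y ∧ ∀ t ∈ Icc x y, dhat δ x ≤ dhat δ t} := by
    rw [hset]
    exact isClosed_Ici.inter
      (isClosed_iInter fun s ↦ isClosed_le continuous_const (by fun_prop))
  refine hcl.isCompact.isGreatest_sSup ⟨x, le_rfl, fun t ht ↦ ?_⟩
  rw [le_antisymm ht.2 ht.1]

theorem isGreatest_gU (δ : I → I) (x : I) : IsGreatest {y : I | (x, y) ∈ region δ} (gU δ x) := by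
  have hcl : IsClosed {y : I | (x, y) ∈ region δ} :=
    (isClosed_closure.union (isClosed_eq continuous_fst continuous_snd)).preimage
      (by fun_prop : Continuous fun y : I ↦ (x, y))
  exact hcl.isCompact.isGreatest_sSup ⟨x, .inr rfl⟩

theorem le_gU (δ : I → I) (x : I) : x ≤ gU δ x := (isGreatest_gU δ x).2 (.inr rfl)

theorem le_hFun_of_mem_HSet {p : I × I} (hp : p ∈ HSet δ) : p.2 ≤ hFun δ p.1 := by
  rcases hp with hp | hp
  · exact le_of_eq hp
  · exact hp.2.2

theorem mem_HSet_of_liminf_le {x y : I} (h1 : liminf (hFun δ) (𝓝[≠] x) ≤ y)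
    (h2 : y ≤ hFun δ x) : (x, y) ∈ HSet δ := by
  by_cases hc : ContinuousAt (hFun δ) x
  · have : Tendsto (hFun δ) (𝓝[≠] x) (𝓝 (hFun δ x)) := hc.tendsto.mono_left nhdsWithin_le_nhds
    rw [this.liminf_eq] at h1
    exact .inl (le_antisymm h2 h1)
  · exact .inr ⟨hc, h1, h2⟩

/-- On the closed region `F ≤ x`. If `F < x` held at `gU x`, which is then below `1`, it would
persist slightly above, contradicting maximality. -/
theorem IsDiagonalSection.upperF_gU (hδ : IsDiagonalSection δ) (x : I) :
    upperF (dhat δ) (totVar δ) x (gU δ x) = x := by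
  have h := hδ.profile
  have hF := h.continuous_upperF
  have hmin : Continuous fun p : I × I ↦ min (p.1 : ℝ) (p.2 : ℝ) := by fun_prop
  apply le_antisymm
  · rcases (isGreatest_gU δ x).1 with hmem | hmem
    · have hsub : closure (openRegion δ) ⊆
          {p | upperF (dhat δ) (totVar δ) p.1 p.2 ≤ min (p.1 : ℝ) p.2} := by
        refine closure_minimal (fun p hp ↦ ?_) (isClosed_le hF hmin)
        have : auxF δ p.1 p.2 < min (p.1 : ℝ) p.2 := hp
        rw [hδ.auxF_eq] at this
        exact this.le
      exact (hsub hmem).trans (min_le_left _ _)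
    · have hx : x = gU δ x := hmem
      rw [← hx, upperF_self]
      linarith [h.nonneg x]
  · by_contra! hlt
    have hne : gU δ x < 1 := by
      refine lt_of_le_of_ne unitInterval.le_one' fun h1 ↦ ?_
      rw [h1] at hlt
      exact hlt.not_ge (h.le_upperF_one x)
    have hev : ∀ᶠ y in 𝓝 (gU δ x), upperF (dhat δ) (totVar δ) x y < x :=
      (hF.comp (by fun_prop : Continuous fun y : I ↦ (x, y))).continuousAt.eventually_lt
        continuousAt_const hlt
    have : (𝓝[>] (gU δ x)).NeBot := nhdsGT_neBot_of_exists_gt ⟨1, hne⟩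
    obtain ⟨y, hy1, hy2, -⟩ := ((hev.filter_mono nhdsWithin_le_nhds).and (Ioo_mem_nhdsGT hne)).exists
    refine hy2.not_ge ((isGreatest_gU δ x).2 (.inl (subset_closure ?_)))
    change auxF δ x y < min (x : ℝ) y
    have hxy : (x : ℝ) ≤ y := (le_gU δ x).trans hy2.le
    rw [hδ.auxF_eq, min_eq_left hxy]
    exact hy1

end Boundary

/-! ### The optimal value `M` -/

/-- `M` is the greatest value of the minimum of `D` on `[x, y]` over all `x ≤ y` with
`x ≤ upperF D T x y`. -/
structure IsOptimalValue (D T : I → ℝ) (M : ℝ) : Prop where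
  nonneg : 0 ≤ M
  le : ∀ x y : I, x ≤ y → (x : ℝ) ≤ upperF D T x y → ∃ t ∈ Icc x y, D t ≤ M
  attained : ∃ x y : I, x ≤ y ∧ (x : ℝ) ≤ upperF D T x y ∧ ∀ t ∈ Icc x y, M ≤ D t

namespace IsOptimalValue

variable {D T : I → ℝ} {M : ℝ}

/-- The optimal value is attained at some `x` with `D x = M`, and there is a greatest such `x`. -/
theorem exists_greatest (hM : IsOptimalValue D T M) (h : Profile D T) :
    ∃ x, IsGreatest {x : I | D x = M ∧ ∃ y, x ≤ y ∧ (x : ℝ) ≤ upperF D T x y ∧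
      ∀ t ∈ Icc x y, M ≤ D t} x := by
  have hD := h.continuous_left
  have hF := h.continuous_upperF
  let K : Set (I × I) := {p | D p.1 = M ∧ p.1 ≤ p.2 ∧ (p.1 : ℝ) ≤ upperF D T p.1 p.2 ∧
    ∀ s : I, M ≤ D (max p.1 (min s p.2))}
  have hK : IsClosed K := by
    refine (isClosed_eq (by fun_prop) (by fun_prop)).inter
      ((isClosed_le (by fun_prop) (by fun_prop)).inter
      ((isClosed_le (by fun_prop) hF).inter ?_))
    have hI : IsClosed (⋂ s : I, {p : I × I | M ≤ D (max p.1 (min s p.2))}) :=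
      isClosed_iInter fun s ↦ isClosed_le (by fun_prop) (by fun_prop)
    rwa [← ofPred_forall] at hI
  have hset : {x : I | D x = M ∧ ∃ y, x ≤ y ∧ (x : ℝ) ≤ upperF D T x y ∧
      ∀ t ∈ Icc x y, M ≤ D t} = Prod.fst '' K := by
    ext x
    constructor
    · rintro ⟨h1, y, h2, h3, h4⟩
      exact ⟨(x, y), ⟨h1, h2, h3, fun s ↦
        h4 _ ⟨le_max_left _ _, max_le h2 (min_le_right _ _)⟩⟩, rfl⟩
    · rintro ⟨⟨x, y⟩, ⟨h1, h2, h3, h4⟩, rfl⟩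
      refine ⟨h1, y, h2, h3, fun t ht ↦ ?_⟩
      have := h4 t
      rwa [min_eq_left ht.2, max_eq_right ht.1] at this
  rw [hset]
  refine (hK.isCompact.image continuous_fst).exists_isGreatest ?_
  rw [← hset]
  obtain ⟨x, y, hxy, hFxy, hmin⟩ := hM.attained
  -- Extend an optimal interval left as far as `D ≥ M` allows. Since `D 0 = 0 ≤ M`, it stops at a
  -- point where `D = M`; feasibility survives because `F(x,y) - x` is antitone in `x`.
  obtain ⟨z, ⟨hzx, hz⟩, hzmin⟩ : ∃ z,
      IsLeast {z : I | z ≤ x ∧ ∀ s : I, M ≤ D (max z (min s x))} z := by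
    refine IsCompact.exists_isLeast (IsClosed.isCompact ?_)
      ⟨x, le_rfl, fun s ↦ by simpa using hmin x ⟨le_rfl, hxy⟩⟩
    refine isClosed_Iic.inter ?_
    have hI : IsClosed (⋂ s : I, {z : I | M ≤ D (max z (min s x))}) :=
      isClosed_iInter fun s ↦ isClosed_le (by fun_prop) (by fun_prop)
    rwa [← ofPred_forall] at hI
  have hz' (t : I) (h1 : z ≤ t) (h2 : t ≤ x) : M ≤ D t := by
    have := hz t
    rwa [min_eq_left h2, max_eq_right h1] at this
  refine ⟨z, le_antisymm ?_ (hz' z le_rfl hzx), y, hzx.trans hxy, ?_, fun t ht ↦ ?_⟩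
  · by_contra! hlt
    have hz0 : 0 < z := by
      refine lt_of_le_of_ne unitInterval.nonneg' fun h0 ↦ ?_
      rw [← h0, h.zero] at hlt
      exact hlt.not_ge hM.nonneg
    have hev : ∀ᶠ w in 𝓝 z, M < D w := hD.continuousAt.eventually (lt_mem_nhds hlt)
    obtain ⟨w, hwz, hw⟩ := exists_Ioc_subset_of_mem_nhds hev ⟨0, hz0⟩
    obtain ⟨v, hwv, hvz⟩ := exists_between hwz
    refine hvz.not_ge (hzmin ⟨hvz.le.trans hzx, fun s ↦ ?_⟩)
    rcases le_total (max v (min s x)) z with hs | hs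
    · exact (hw ⟨hwv.trans_le (le_max_left _ _), hs⟩ : M < _).le
    · exact hz' _ hs (max_le (hvz.le.trans hzx) (min_le_right _ _))
  · linarith [h.upperF_sub_antitone hzx y]
  · rcases le_total t x with hs | hs
    · exact hz' t ht.1 hs
    · exact hmin t ⟨hs, ht.2⟩

/-- If `a ≤ min (x, upperF D T x y)` and `b ≥ x - D t` on `[x, y]`, then `a - b` is at most the
optimal value. -/
theorem min_sub_le (hM : IsOptimalValue D T M) (h : Profile D T) {x y : I} (hxy : x ≤ y) {a b : ℝ}
    (ha : a ≤ x) (haF : a ≤ upperF D T x y) (hb : ∀ t ∈ Icc x y, x - D t ≤ b) : a - b ≤ M := by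
  rcases le_total (x : ℝ) (upperF D T x y) with hle | hle
  · obtain ⟨t, ht, hDt⟩ := hM.le x y hxy hle
    linarith [hb t ht]
  -- Push `y` right until the constraint becomes tight. If the minimum is reached beyond `y`, the
  -- drop of `D` is at most `x - F(x,y)`.
  · obtain ⟨y', hy', hFy'⟩ : (x : ℝ) ∈ upperF D T x '' Icc y 1 := by
      refine intermediate_value_Icc unitInterval.le_one'
        (h.continuous_upperF.comp (by fun_prop : Continuous fun y : I ↦ (x, y))).continuousOn
        ⟨hle, h.le_upperF_one x⟩
    obtain ⟨t, ht, hDt⟩ := hM.le x y' (hxy.trans hy'.1) hFy'.ge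
    rcases le_total t y with hty | hty
    · linarith [hb t ⟨ht.1, hty⟩]
    · linarith [hb y ⟨hxy, le_rfl⟩, h.sub_le_upperF_sub x hty, h.upperF_mono_right x ht.2]

/-- Let `(a,b)` be the component of `{D > 0}` containing `z`. Then `F(a,b) ≥ (a + b)/2 > a`, so by
continuity a feasible interval fits strictly inside, where `D` is positive. -/
theorem pos (hM : IsOptimalValue D T M) (h : Profile D T) {z : I} (hz : 0 < D z) : 0 < M := by
  have hD := h.continuous_left
  have hF := h.continuous_upperF
  have hcl : IsClosed {x : I | D x = 0} := isClosed_eq hD continuous_const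
  obtain ⟨a, ⟨ha, haz⟩, hamax⟩ := (hcl.inter isClosed_Iic).isCompact.exists_isGreatest
    ⟨0, h.zero, (unitInterval.nonneg' : 0 ≤ z)⟩
  obtain ⟨b, ⟨hb, hbz⟩, hbmin⟩ := (hcl.inter isClosed_Ici).isCompact.exists_isLeast
    ⟨1, h.one, (unitInterval.le_one' : z ≤ 1)⟩
  have ha : D a = 0 := ha
  have hb : D b = 0 := hb
  have haz : a < z := lt_of_le_of_ne haz fun e ↦ by rw [← e, ha] at hz; exact hz.false
  have hzb : z < b := lt_of_le_of_ne hbz fun e ↦ by rw [e, hb] at hz; exact hz.false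
  have hpos (t : I) (h1 : a < t) (h2 : t < b) : 0 < D t := by
    refine lt_of_le_of_ne (h.nonneg t) fun e ↦ ?_
    rcases le_total t z with h3 | h3
    · exact h1.not_ge (hamax ⟨e.symm, h3⟩)
    · exact h2.not_ge (hbmin ⟨e.symm, h3⟩)
  have hab : (a : ℝ) < upperF D T a b := by
    have h1 : (a : ℝ) < b := haz.trans hzb
    have h2 := h.sub_le a b (haz.trans hzb).le
    rw [upperF, ha, hb]
    linarith
  have : (𝓝[>] a).NeBot := nhdsGT_neBot_of_exists_gt ⟨z, haz⟩
  have : (𝓝[<] b).NeBot := nhdsLT_neBot_of_exists_lt ⟨z, hzb⟩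
  have e1 : ∀ᶠ x : I in 𝓝 a, (x : ℝ) < upperF D T x b :=
    ContinuousAt.eventually_lt (by fun_prop)
      (hF.comp (by fun_prop : Continuous fun x : I ↦ (x, b))).continuousAt hab
  obtain ⟨x, hx, hxa, hxz⟩ := ((e1.filter_mono nhdsWithin_le_nhds).and (Ioo_mem_nhdsGT haz)).exists
  have e2 : ∀ᶠ y : I in 𝓝 b, (x : ℝ) < upperF D T x y :=
    ContinuousAt.eventually_lt (by fun_prop)
      (hF.comp (by fun_prop : Continuous fun y : I ↦ (x, y))).continuousAt hx
  obtain ⟨y, hy, hyz, hyb⟩ := ((e2.filter_mono nhdsWithin_le_nhds).and (Ioo_mem_nhdsLT hzb)).exists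
  obtain ⟨t, ht, hDt⟩ := hM.le x y (hxz.trans hyz).le hy.le
  exact (hpos t (hxa.trans_le ht.1) (ht.2.trans_lt hyb)).trans_le hDt

end IsOptimalValue

/-! ### The optimal value on `HSet δ` and the maximal asymmetry -/

section Main

variable {δ : I → I} {M : ℝ}

theorem IsDiagonalSection.isLeast_of_mem_HSet (hδ : IsDiagonalSection δ) {x : I}
    (hx : (x, gU δ x) ∈ HSet δ) : IsLeast (dhat δ '' Icc x (gU δ x)) (dhat δ x) := by
  refine ⟨mem_image_of_mem _ ⟨le_rfl, le_gU δ x⟩, ?_⟩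
  rintro _ ⟨t, ht, rfl⟩
  exact (isGreatest_hFun hδ.profile.continuous_left x).1.2 t
    ⟨ht.1, ht.2.trans (le_hFun_of_mem_HSet hx)⟩

theorem IsOptimalValue.dhat_le (hM : IsOptimalValue (dhat δ) (totVar δ) M)
    (hδ : IsDiagonalSection δ) {x : I} (hx : (x, gU δ x) ∈ HSet δ) : dhat δ x ≤ M := by
  obtain ⟨t, ht, hDt⟩ := hM.le x (gU δ x) (le_gU δ x) (hδ.upperF_gU x).ge
  exact ((hδ.isLeast_of_mem_HSet hx).2 (mem_image_of_mem _ ht)).trans hDt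

theorem IsOptimalValue.exists_mem_HSet (hM : IsOptimalValue (dhat δ) (totVar δ) M)
    (hδ : IsDiagonalSection δ) : ∃ x, (x, gU δ x) ∈ HSet δ ∧ dhat δ x = M := by
  have h := hδ.profile
  have hD := h.continuous_left
  have hgr := isGreatest_hFun hD
  rcases hM.nonneg.eq_or_lt with h0 | hpos
  -- When `M = 0` the corner works: `gU 1 = hFun 1 = 1`.
  · refine ⟨1, .inl ?_, h0 ▸ h.one⟩
    exact (le_antisymm unitInterval.le_one' (le_gU δ 1)).trans
      (le_antisymm (hgr 1).1.1 unitInterval.le_one')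
  obtain ⟨x, ⟨hxM, y, hxy, hFy, hmin⟩, hxmax⟩ := hM.exists_greatest h
  have hFg := hδ.upperF_gU x
  have hxg : x < gU δ x := by
    refine lt_of_le_of_ne (le_gU δ x) fun e ↦ ?_
    rw [← e, upperF_self, hxM] at hFg
    linarith
  have hgh : gU δ x ≤ hFun δ x := by
    refine (hgr x).2 ⟨hxg.le, fun t ht ↦ ?_⟩
    rw [hxM]
    rcases le_total t y with hty | hty
    · exact hmin t ⟨ht.1, hty⟩
    -- Between `y` and `gU x` the monotone `F(x,·)` is squeezed to the constant `x`, so `D` cannot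
    -- decrease there.
    · have h1 := h.upperF_mono_right x ht.2
      have h2 := abs_le.1 (h.abs_sub_le y t hty)
      have h3 := h.sub_le y t hty
      have h4 := hmin y ⟨hxy, le_rfl⟩
      unfold upperF at h1 hFg hFy
      linarith
  refine ⟨x, mem_HSet_of_liminf_le ?_ hgh, hxM⟩
  -- Otherwise, for `c` strictly between `gU x` and the liminf, points `z` just right of `x` have
  -- `hFun z > c` and `(z,c)` outside the region. Then `[z,c]` is feasible with minimum `D z = M`,
  -- contradicting the choice of `x` as rightmost.
  by_contra! hlt
  obtain ⟨c, hgc, hcL⟩ := exists_between hlt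
  have hxc : x < c := hxg.trans hgc
  have e1 : ∀ᶠ z in 𝓝[>] x, c < hFun δ z :=
    nhdsWithin_mono x (fun z hz ↦ ne_of_gt hz) (eventually_lt_of_lt_liminf hcL)
  have e2 : ∀ᶠ z : I in 𝓝 x, (z, c) ∉ region δ := by
    have hop : IsOpen (region δ)ᶜ :=
      (isClosed_closure.union (isClosed_eq continuous_fst continuous_snd)).isOpen_compl
    exact (hop.preimage (by fun_prop : Continuous fun z : I ↦ (z, c))).mem_nhds
      fun hmem ↦ hgc.not_ge ((isGreatest_gU δ x).2 hmem)
  have : (𝓝[>] x).NeBot := nhdsGT_neBot_of_exists_gt ⟨c, hxc⟩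
  obtain ⟨z, ⟨hz1, hz2⟩, hxz, hzg⟩ :=
    ((e1.and (e2.filter_mono nhdsWithin_le_nhds)).and (Ioo_mem_nhdsGT hxg)).exists
  have hzc : z < c := hzg.trans hgc
  have hFz : (z : ℝ) ≤ upperF (dhat δ) (totVar δ) z c := by
    by_contra! hl
    refine hz2 (.inl (subset_closure ?_))
    change auxF δ z c < min (z : ℝ) c
    have hzc' : (z : ℝ) ≤ c := hzc.le
    rwa [hδ.auxF_eq, min_eq_left hzc']
  have hzmin (t : I) (ht : t ∈ Icc z c) : dhat δ z ≤ dhat δ t :=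
    (hgr z).1.2 t ⟨ht.1, ht.2.trans hz1.le⟩
  have hzM : dhat δ z = M := by
    apply le_antisymm
    · obtain ⟨t, ht, hDt⟩ := hM.le z c hzc.le hFz
      exact (hzmin t ht).trans hDt
    · rw [← hxM]
      exact (hgr x).1.2 z ⟨hxz.le, hzg.le.trans hgh⟩
  exact hxz.not_ge (hxmax ⟨hzM, c, hzc.le, hFz, fun t ht ↦ hzM ▸ hzmin t ht⟩)

theorem IsOptimalValue.abs_sub_le (hM : IsOptimalValue (dhat δ) (totVar δ) M)
    (hδ : IsDiagonalSection δ) {C : I → I → I} (hC : IsCopula C) (hd : HasDiagonal C δ)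
    (x y : I) : |(C x y : ℝ) - C y x| ≤ M := by
  have key {C : I → I → I} (hC : IsCopula C) (hd : HasDiagonal C δ) {x y : I} (hxy : x ≤ y) :
      (C x y : ℝ) - C y x ≤ M :=
    hM.min_sub_le hδ.profile hxy (hC.le_left x y) (hδ.auxF_eq ▸ hC.le_auxF hd hxy)
      fun t ht ↦ hC.isQuasiCopula.sub_dhat_le hd ht
  rcases le_total x y with h | h
  · exact abs_sub_le_iff.2 ⟨key hC hd h, key hC.transpose hd h⟩
  · exact abs_sub_le_iff.2 ⟨key hC.transpose hd h, key hC hd h⟩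

/-- One copula serves all admissible `x` at once, so it settles `maxAsymmetry`, `upperBound` and
`bertino` together. -/
theorem IsDiagonalSection.exists_extremal (hδ : IsDiagonalSection δ) : ∃ C : I → I → I,
    IsCopula C ∧ HasDiagonal C δ ∧ ∀ x, (x, gU δ x) ∈ HSet δ →
      C x (gU δ x) = x ∧ (C (gU δ x) x : ℝ) = x - dhat δ x := by
  obtain ⟨C, hC, hU, hV⟩ := hδ.profile.exists_isCopula
  refine ⟨C, hC, fun x ↦ Subtype.ext ?_, fun x hx ↦ ⟨Subtype.ext ?_, ?_⟩⟩
  · rw [hV x x le_rfl, intervalMin, Icc_self, image_singleton, csInf_singleton, dhat]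
    ring
  · rw [hU x _ (le_gU δ x), hδ.upperF_gU, min_self]
  · rw [hV x _ (le_gU δ x)]
    congr 1
    exact (hδ.profile.isLeast_intervalMin (le_gU δ x)).unique (hδ.isLeast_of_mem_HSet hx)

theorem le_asymmetry (C : I → I → I) (x y : I) : (C x y : ℝ) - C y x ≤ asymmetry C := by
  refine (le_abs_self _).trans (le_csSup ⟨1, ?_⟩ ⟨x, y, rfl⟩)
  rintro _ ⟨x, y, rfl⟩
  exact abs_sub_le_iff.2 ⟨by linarith [(C x y).2.2, (C y x).2.1],
    by linarith [(C y x).2.2, (C x y).2.1]⟩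

theorem IsOptimalValue.asymmetry_le (hM : IsOptimalValue (dhat δ) (totVar δ) M)
    (hδ : IsDiagonalSection δ) {C : I → I → I} (hC : IsCopula C) (hd : HasDiagonal C δ) :
    asymmetry C ≤ M := by
  refine csSup_le ⟨_, 0, 0, rfl⟩ ?_
  rintro _ ⟨x, y, rfl⟩
  exact hM.abs_sub_le hδ hC hd x y

theorem IsOptimalValue.maxAsymmetry_eq (hM : IsOptimalValue (dhat δ) (totVar δ) M)
    (hδ : IsDiagonalSection δ) : maxAsymmetry δ = M := by
  have hb : ∀ r ∈ {r : ℝ | ∃ C, IsCopula C ∧ HasDiagonal C δ ∧ r = asymmetry C}, r ≤ M := by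
    rintro _ ⟨C, hC, hd, rfl⟩
    exact hM.asymmetry_le hδ hC hd
  obtain ⟨C, hC, hd, hCx⟩ := hδ.exists_extremal
  refine le_antisymm (csSup_le ⟨_, C, hC, hd, rfl⟩ hb) ?_
  obtain ⟨x, hx, hxM⟩ := hM.exists_mem_HSet hδ
  have h1 := le_asymmetry C x (gU δ x)
  rw [(hCx x hx).1, (hCx x hx).2, hxM] at h1
  exact (by linarith : M ≤ asymmetry C).trans (le_csSup ⟨M, hb⟩ ⟨C, hC, hd, rfl⟩)

theorem IsDiagonalSection.upperBound_gU (hδ : IsDiagonalSection δ) {x : I}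
    (hx : (x, gU δ x) ∈ HSet δ) : upperBound δ x (gU δ x) = x := by
  obtain ⟨C, hC, hd, hCx⟩ := hδ.exists_extremal
  apply le_antisymm
  · refine sSup_le ?_
    rintro _ ⟨C', hC', -, rfl⟩
    exact hC'.le_left x (gU δ x)
  · exact le_sSup ⟨C, hC, hd, (hCx x hx).1.symm⟩

theorem IsDiagonalSection.bertino_gU (hδ : IsDiagonalSection δ) {x : I}
    (hx : (x, gU δ x) ∈ HSet δ) : bertino δ (gU δ x) x = δ x := by
  obtain ⟨C, hC, hd, hCx⟩ := hδ.exists_extremal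
  have hCx' : C (gU δ x) x = δ x := Subtype.ext (by rw [(hCx x hx).2, dhat]; ring)
  apply le_antisymm
  · exact sInf_le ⟨C, hC.isQuasiCopula, hd, hCx'.symm⟩
  · refine le_sInf ?_
    rintro _ ⟨Q, hQ, hdQ, rfl⟩
    rw [← hdQ x]
    exact hQ.mono_left _ _ _ (le_gU δ x)

theorem IsDiagonalSection.splice_sub_splice (hδ : IsDiagonalSection δ) {x : I}
    (hx : (x, gU δ x) ∈ HSet δ) :
    (splice (upperBound δ) (bertino δ) x (gU δ x) : ℝ) -
      splice (upperBound δ) (bertino δ) (gU δ x) x = dhat δ x := by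
  have h1 := hδ.upperBound_gU hx
  have h2 := hδ.bertino_gU hx
  have hle := le_gU δ x
  rw [splice, if_pos hle, h1]
  rcases hle.lt_or_eq with hlt | heq
  · rw [splice, if_neg hlt.not_ge, h2, dhat]
  -- On the diagonal the splice takes its upper branch in both terms, and `upperBound` equals `δ`
  -- there.
  · rw [← heq] at h1 h2 ⊢
    have hself : upperBound δ x x = δ x := by
      obtain ⟨C, hC, hd⟩ := hδ
      apply le_antisymm
      · refine sSup_le ?_
        rintro _ ⟨C', -, hd', rfl⟩
        exact (hd' x).le
      · exact le_sSup ⟨C, hC, hd, (hd x).symm⟩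
    rw [splice, if_pos le_rfl, hself, dhat]

end Main

end DiagCopula

theorem mainTheorem7 (δ : I → I) (hδ : DiagCopula.IsDiagonalSection δ) :
    (∀ x : I, (x, DiagCopula.gU δ x) ∈ DiagCopula.HSet δ →
      IsLeast (DiagCopula.dhat δ '' Icc x (DiagCopula.gU δ x)) (DiagCopula.dhat δ x)) ∧
    (∃ x₀ : I, (x₀, DiagCopula.gU δ x₀) ∈ DiagCopula.HSet δ ∧
      DiagCopula.maxAsymmetry δ =
        (DiagCopula.splice (DiagCopula.upperBound δ) (DiagCopula.bertino δ)
          x₀ (DiagCopula.gU δ x₀) : ℝ) -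
        (DiagCopula.splice (DiagCopula.upperBound δ) (DiagCopula.bertino δ)
          (DiagCopula.gU δ x₀) x₀ : ℝ) ∧
      DiagCopula.maxAsymmetry δ = DiagCopula.dhat δ x₀) ∧
    (δ ≠ id →
      IsGreatest
        (DiagCopula.dhat δ ''
          {x : I | (x, DiagCopula.gU δ x) ∈ DiagCopula.HSet δ ∧ x < DiagCopula.gU δ x})
        (DiagCopula.maxAsymmetry δ)) := by
  obtain ⟨M, h1, h2, h3⟩ := hδ.profile.exists_max_intervalMin
  have hM : DiagCopula.IsOptimalValue (DiagCopula.dhat δ) (DiagCopula.totVar δ) M := ⟨h1, h2, h3⟩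
  have hμ := hM.maxAsymmetry_eq hδ
  obtain ⟨x, hx, hxM⟩ := hM.exists_mem_HSet hδ
  refine ⟨fun x hx ↦ hδ.isLeast_of_mem_HSet hx, ⟨x, hx, ?_, hμ.trans hxM.symm⟩, fun hne ↦ ?_⟩
  · rw [hδ.splice_sub_splice hx, hμ, hxM]
  · obtain ⟨z, hz⟩ := Function.ne_iff.1 hne
    have hz' : 0 < DiagCopula.dhat δ z := by
      refine lt_of_le_of_ne (hδ.profile.nonneg z) fun e ↦ hz (Subtype.ext ?_)
      exact (sub_eq_zero.1 e.symm).symm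
    have hpos := hM.pos hδ.profile hz'
    rw [hμ]
    refine ⟨⟨x, ⟨hx, lt_of_le_of_ne (DiagCopula.le_gU δ x) fun e ↦ ?_⟩, hxM⟩, ?_⟩
    -- If `gU x = x`, then `x = F(x,x) = x - M`, against `M > 0`.
    · have h4 := hδ.upperF_gU x
      rw [← e, DiagCopula.upperF_self, hxM] at h4
      linarith
    · rintro _ ⟨w, ⟨hw, -⟩, rfl⟩
      exact hM.dhat_le hδ hw
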